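/- Let $(K,v)$ be a Henselian valued field (written additively, of arbitrary rank), $\overline K$ an algebraic closure of $K$, denote again by $v$ the unique extension of $v$ to $\overline K$, and let $\Gamma=v(\overline K^*)$. For $\beta\in\overline K$ put $\deg_K\beta=[K(\beta):K]$. A finite extension $L/K$ in $\overline K$, with value group $vL$ and residue field $Lv$, has ramification index $e(L/K)=(vL:vK)$ and inertia degree $f(L/K)=[Lv:Kv]$. It is *defectless* if $[L:K]=e(L/K)f(L/K)$, and *tame* if it is separable and defectless, $Lv/Kv$ is separable, and $e(L/K)$ is not divisible by $\operatorname{char}(Kv)$. An element $\beta\in\overline K$ is called separable, defectless or tame if $K(\beta)/K$ is. Let $\theta\in\overline K$ be separable and defectless over $K$. (1) Let $[\alpha_0,\alpha_1,\dots,\alpha_r=\theta]$ be an Okutsu sequence of $\theta$; that is, $\alpha_i\in\overline K$, $1=\deg_K\alpha_0<\deg_K\alpha_1<\dots<\deg_K\alpha_r=\deg_K\theta$, and for all $0\le i<r$ and $\beta\in\overline K$: $$\deg_K\beta<\deg_K\alpha_{i+1}\Rightarrow v(\theta-\beta)\le v(\theta-\alpha_i),\qquad \deg_K\beta<\deg_K\alpha_i\Rightarrow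 v(\theta-\beta)<v(\theta-\alpha_i).$$ Put $\delta_{-1}=-\infty$ and $\delta_i=v(\theta-\alpha_i)$ for $0\le i\le r$ (so $\delta_r=\infty$). Let $0\le i\le r$, let $M/K$ be a finite Galois extension in $\overline K$ with $K(\theta,\alpha_i)\subseteq M$, and let $G=\operatorname{Gal}(M/K)$. If $\alpha_i$ is tame, then the subgroups $$H_i=\{\sigma\in G\mid v(\theta-\sigma(\theta))>\delta_{i-1}\}\quad\text{and}\quad \overline H_i=\{\sigma\in G\mid v(\theta-\sigma(\theta))\ge\delta_i\}$$ of $G$ coincide: $H_i=\overline H_i$. (2) If $\theta\notin K$ and $\theta$ is tame, then the main invariant $\delta(\theta)=\sup\{v(\theta-\alpha)\mid\alpha\in\overline K,\ \deg_K\alpha<\deg_K\theta\}$ exists in $\Gamma$ and equals Krasner's constant $\omega(\theta)=\max\{v(\theta-\theta')\mid\theta'\ne\theta,\ \theta'\text{ a root in }\overline K\text{ of the minimal polynomial of }\theta\text{ over }K\}$, that is, $\delta(\theta)=\omega(\theta)$. -/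

import Mathlib

open scoped IntermediateField

namespace TameOkutsu

section Valued

variable {Γ : Type*} [AddCommGroup Γ] [LinearOrder Γ] [IsOrderedAddMonoid Γ]

/-- The valuation ring `{x | 0 ≤ v x}` of an additively written valuation with values in
`Γ ∪ {∞}` on a field. -/
def valuationRing {E : Type*} [Field E] (v : AddValuation E (WithTop Γ)) : ValuationSubring E where
  carrier := {x | 0 ≤ v x}
  mul_mem' {x y} hx hy := by
    have h : 0 ≤ v x + v y := add_nonneg hx hy
    simpa using h
  one_mem' := by simp
  add_mem' {x y} hx hy := v.map_le_add hx hy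
  zero_mem' := by simp
  neg_mem' {x} hx := by simpa using hx
  mem_or_inv_mem' x := by
    rcases le_total 0 (v x) with h | h
    · exact Or.inl h
    · right
      by_cases hx : x = 0
      · simp [hx]
      · have h1 : v x + v x⁻¹ = 0 := by rw [← v.map_mul, mul_inv_cancel₀ hx, v.map_one]
        show 0 ≤ v x⁻¹
        rw [← h1]
        exact (add_le_add_left h _).trans (by simp)

variable {K E : Type*} [Field K] [Field E] [Algebra K E]

/-- The valued field `(K, v)` is Henselian: `v` has a unique extension (up to equivalence, that is,
as a valuation ring) to the algebraic closure `E` of `K`. -/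
def IsHenselian (E : Type*) [Field E] [Algebra K E] [IsAlgClosure K E]
    (v : AddValuation K (WithTop Γ)) : Prop :=
  ∃! A : ValuationSubring E, A.comap (algebraMap K E) = valuationRing v

/-- The value group `vL = v(L^*)` of an intermediate field `L`. -/
def valueGroup (v : AddValuation E (WithTop Γ)) (L : IntermediateField K E) : AddSubgroup Γ where
  carrier := {γ | ∃ x ∈ L, v x = (γ : WithTop Γ)}
  add_mem' := by
    rintro a b ⟨x, hx, hxa⟩ ⟨y, hy, hyb⟩
    exact ⟨x * y, L.mul_mem hx hy, by simp [hxa, hyb]⟩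
  zero_mem' := ⟨1, L.one_mem, by simp⟩
  neg_mem' := by
    rintro a ⟨x, hx, hxa⟩
    refine ⟨x⁻¹, L.inv_mem hx, ?_⟩
    rw [v.map_inv, hxa]
    rfl

/-- The residue field `Lv` of an intermediate field `L`, realized as the subfield of the residue
field of `E` that consists of the residue classes of the integral elements of `L`. -/
def residueField (v : AddValuation E (WithTop Γ)) (L : IntermediateField K E) :
    Subfield (IsLocalRing.ResidueField (valuationRing v)) where
  carrier := {c | ∃ x : valuationRing v, (x : E) ∈ L ∧ IsLocalRing.residue (valuationRing v) x = c}
  mul_mem' := by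
    rintro _ _ ⟨x, hx, rfl⟩ ⟨y, hy, rfl⟩
    exact ⟨x * y, L.mul_mem hx hy, map_mul _ _ _⟩
  one_mem' := ⟨1, L.one_mem, map_one _⟩
  add_mem' := by
    rintro _ _ ⟨x, hx, rfl⟩ ⟨y, hy, rfl⟩
    exact ⟨x + y, L.add_mem hx hy, map_add _ _ _⟩
  zero_mem' := ⟨0, L.zero_mem, map_zero _⟩
  neg_mem' := by
    rintro _ ⟨x, hx, rfl⟩
    exact ⟨-x, L.neg_mem hx, map_neg _ _⟩
  inv_mem' := by
    rintro _ ⟨x, hx, rfl⟩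
    by_cases hu : IsUnit x
    · obtain ⟨u, rfl⟩ := hu
      have hval : (((u⁻¹ : (valuationRing v)ˣ) : valuationRing v) : E)
          = ((u : valuationRing v) : E)⁻¹ := by
        apply eq_inv_of_mul_eq_one_left
        have h := u.inv_mul
        exact congrArg Subtype.val h
      refine ⟨((u⁻¹ : (valuationRing v)ˣ) : valuationRing v), ?_, ?_⟩
      · rw [hval]
        exact L.inv_mem hx
      · apply eq_inv_of_mul_eq_one_left
        rw [← map_mul, u.inv_mul, map_one]
    · have h0 : IsLocalRing.residue (valuationRing v) x = 0 := by
        rw [IsLocalRing.residue_eq_zero_iff]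
        exact hu
      exact ⟨0, L.zero_mem, by rw [h0, inv_zero, map_zero]⟩

/-- The ramification index `e(L/K) = (vL : vK)`. -/
noncomputable def ramificationIndex (v : AddValuation E (WithTop Γ))
    (L : IntermediateField K E) : ℕ :=
  (valueGroup v (⊥ : IntermediateField K E)).relIndex (valueGroup v L)

/-- The inertia degree `f(L/K) = [Lv : Kv]`. -/
noncomputable def inertiaDegree (v : AddValuation E (WithTop Γ))
    (L : IntermediateField K E) : ℕ :=
  Subfield.relfinrank (residueField v (⊥ : IntermediateField K E)) (residueField v L)

/-- The finite extension `L/K` is defectless: `[L : K] = e(L/K) f(L/K)`. -/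
def IsDefectless (v : AddValuation E (WithTop Γ)) (L : IntermediateField K E) : Prop :=
  Module.finrank K L = ramificationIndex v L * inertiaDegree v L

/-- The finite extension `L/K` is tame: it is separable and defectless, `Lv/Kv` is separable, and
`e(L/K)` is not divisible by the characteristic of `Kv`. -/
structure IsTame (v : AddValuation E (WithTop Γ)) (L : IntermediateField K E) : Prop where
  separable : Algebra.IsSeparable K L
  defectless : IsDefectless v L
  residue_separable : ∀ c ∈ residueField v L,
    IsSeparable (residueField v (⊥ : IntermediateField K E)) c
  not_dvd : ¬ ringChar (residueField v (⊥ : IntermediateField K E)) ∣ ramificationIndex v L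

variable (K) in
/-- The degree over `K` of an (algebraic) element. -/
noncomputable def deg (β : E) : ℕ := (minpoly K β).natDegree

variable (K) in
/-- `[α₀, …, α_r]` is a (classical) Okutsu sequence of `θ`. -/
structure IsOkutsuSequence (v : AddValuation E (WithTop Γ)) (θ : E) {r : ℕ}
    (α : Fin (r + 1) → E) : Prop where
  last_eq : α (Fin.last r) = θ
  deg_zero : deg K (α 0) = 1
  deg_strictMono : StrictMono fun i => deg K (α i)
  le_of_deg_lt_succ : ∀ (i : Fin r) (β : E), deg K β < deg K (α i.succ) →
    v (θ - β) ≤ v (θ - α i.castSucc)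
  lt_of_deg_lt : ∀ (i : Fin r) (β : E), deg K β < deg K (α i.castSucc) →
    v (θ - β) < v (θ - α i.castSucc)

/-- The set `H_i = {σ ∈ Gal(M/K) | v(θ - σ(θ)) > δ_{i-1}}`, where `δ_j = v(θ - α_j)` for `0 ≤ j`
and `δ_{-1} = -∞` (so that for `i = 0` the condition on `σ` is void). -/
def H (v : AddValuation E (WithTop Γ)) {M : IntermediateField K E} (θ : M) {r : ℕ}
    (α : Fin (r + 1) → E) (i : Fin (r + 1)) : Set Gal(M/K) :=
  {σ | ∀ j : Fin (r + 1), (j : ℕ) + 1 = i → v ((θ : E) - α j) < v ((θ : E) - (σ θ : M))}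

/-- The set `H̄_i = {σ ∈ Gal(M/K) | v(θ - σ(θ)) ≥ δ_i}`, where `δ_i = v(θ - α_i)`
(so `δ_r = ∞` if `α_r = θ`). -/
def HBar (v : AddValuation E (WithTop Γ)) {M : IntermediateField K E} (θ : M) {r : ℕ}
    (α : Fin (r + 1) → E) (i : Fin (r + 1)) : Set Gal(M/K) :=
  {σ | v ((θ : E) - α i) ≤ v ((θ : E) - (σ θ : M))}

variable (K) in
/-- `d` is the main invariant `δ(θ) = sup {v(θ - α) | deg α < deg θ}`. -/
def IsMainInvariant (v : AddValuation E (WithTop Γ)) (θ : E) (d : Γ) : Prop :=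
  IsLUB {γ : Γ | ∃ α : E, deg K α < deg K θ ∧ v (θ - α) = (γ : WithTop Γ)} d

variable (K) in
/-- `d` is Krasner's constant `ω(θ) = max {v(θ - θ') | θ' ≠ θ a root of Irr_K(θ)}`. -/
def IsKrasnerConstant (v : AddValuation E (WithTop Γ)) (θ : E) (d : Γ) : Prop :=
  IsGreatest {γ : Γ | ∃ θ' ∈ (minpoly K θ).rootSet E, θ' ≠ θ ∧ v (θ - θ') = (γ : WithTop Γ)} d

end Valued

end TameOkutsu

open scoped IntermediateField

namespace TameOkutsu

/-! ### Galois invariance of the extended valuation -/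

section Invariance

variable {Γ : Type*} [AddCommGroup Γ] [LinearOrder Γ] [IsOrderedAddMonoid Γ]
variable {K E : Type*} [Field K] [Field E] [Algebra K E]

/-! Both statements rest on one property of a tame element `a` (`IsTame.exists_deg_lt`): for each
conjugate `τ a ≠ a` some `β` of smaller degree satisfies `w (a - τ a) ≤ w (a - β)`. Tameness gives
an integral `c` in `K(a)` whose trace is a unit. A basis of `K(a)` formed by products of value group
representatives and lifted residue basis elements shows that the trace of `c` reduces to `e` times
the residue trace, which can be made `e`, nonzero in `Kv`. The embeddings `φ` of `K(a)` are then
grouped by the ball of radius `w (a - τ a)` containing `φ a`. Automorphisms preserve `w` and permute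
these balls transitively, so the sum of the `φ c` over each ball is a unit. Take for `β` the mean of
the `φ a` in the ball of `a`, with weights `φ c`: it stays in the ball and is fixed by its
stabilizer, which contains `τ`. In (2) this is the converse of the inequality given by Krasner's
lemma. In (1), if `w (θ - σ θ)` lay strictly between `δ_{i-1}` and `δ_i`, then `α_i` would be moved
by exactly that distance, and `β` would contradict the optimality of `α_{i-1}`. -/

theorem mem_valuationRing {v : AddValuation E (WithTop Γ)} {x : E} :
    x ∈ valuationRing v ↔ 0 ≤ v x := Iff.rfl

theorem div_mem_valuationRing_iff {v : AddValuation E (WithTop Γ)} {x y : E} (hy : y ≠ 0) :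
    x / y ∈ valuationRing v ↔ v y ≤ v x := by
  have h : v x = v (x / y) + v y := by rw [← v.map_mul, div_mul_cancel₀ _ hy]
  have hy' : v y ≠ ⊤ := v.ne_top_iff.2 hy
  rw [mem_valuationRing, h]
  constructor
  · intro h
    simpa using add_le_add_left h (v y)
  · intro h
    have : 0 + v y ≤ v (x / y) + v y := by simpa using h
    exact (WithTop.add_le_add_iff_right hy').1 this

theorem IsHenselian.map_mem_valuationRing_iff [IsAlgClosure K E] {v : AddValuation K (WithTop Γ)}
    (hv : IsHenselian E v) {w : AddValuation E (WithTop Γ)} (hw : ∀ x : K, w (algebraMap K E x) = v x)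
    (σ : E ≃ₐ[K] E) (x : E) : σ x ∈ valuationRing w ↔ x ∈ valuationRing w := by
  have h1 : (valuationRing w).comap (algebraMap K E) = valuationRing v := by
    ext x
    simp [ValuationSubring.mem_comap, mem_valuationRing, hw]
  have h2 : ((valuationRing w).comap (σ : E →+* E)).comap (algebraMap K E) = valuationRing v := by
    ext x
    simp [ValuationSubring.mem_comap, mem_valuationRing, hw]
  exact SetLike.ext_iff.1 (hv.unique h2 h1) x

theorem iterate_algEquiv_eq_self [Algebra.IsAlgebraic K E] (σ : E ≃ₐ[K] E) (x : E) :
    ∃ n : ℕ, 0 < n ∧ (σ ^ n) x = x := by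
  classical
  have hx : IsIntegral K x := (Algebra.IsAlgebraic.isAlgebraic x).isIntegral
  have hfin : ((minpoly K x).rootSet E).Finite := Polynomial.rootSet_finite _ _
  have hmem : ∀ n : ℕ, (σ ^ n) x ∈ (minpoly K x).rootSet E := fun n => by
    rw [Polynomial.mem_rootSet]
    refine ⟨minpoly.ne_zero hx, ?_⟩
    rw [Polynomial.aeval_algHom_apply, minpoly.aeval, map_zero]
  obtain ⟨m, -, n, -, hmn, h⟩ := Set.infinite_univ.exists_ne_map_eq_of_mapsTo
    (f := fun n : ℕ => (σ ^ n) x) (fun n _ => hmem n) hfin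
  wlog hlt : m < n generalizing m n
  · exact this n m hmn.symm h.symm (lt_of_le_of_ne (not_lt.1 hlt) hmn.symm)
  refine ⟨n - m, Nat.sub_pos_of_lt hlt, (σ ^ m).injective ?_⟩
  have : (σ ^ m) ((σ ^ (n - m)) x) = (σ ^ n) x := by
    rw [← AlgEquiv.mul_apply, ← pow_add, Nat.add_sub_cancel' hlt.le]
  rw [this]
  exact h.symm

/-- Uniqueness only says that `σ` preserves the valuation ring, hence comparisons of values. If `w
(σ x)` and `w x` differed, the values along the orbit of `x` would be strictly monotone, but the
orbit is periodic. -/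
theorem IsHenselian.map_algEquiv [IsAlgClosure K E] {v : AddValuation K (WithTop Γ)}
    (hv : IsHenselian E v) {w : AddValuation E (WithTop Γ)} (hw : ∀ x : K, w (algebraMap K E x) = v x)
    (σ : E ≃ₐ[K] E) (x : E) : w (σ x) = w x := by
  have : Algebra.IsAlgebraic K E := IsAlgClosure.isAlgebraic
  by_cases hx : x = 0
  · simp [hx]
  have hmono : ∀ (τ : E ≃ₐ[K] E) (a b : E), b ≠ 0 → (w (τ b) ≤ w (τ a) ↔ w b ≤ w a) := by
    intro τ a b hb
    rw [← div_mem_valuationRing_iff hb, ← div_mem_valuationRing_iff (by simpa using hb), ← map_div₀,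
      hv.map_mem_valuationRing_iff hw]
  obtain ⟨n, hn, hσ⟩ := iterate_algEquiv_eq_self σ x
  obtain ⟨n, rfl⟩ : ∃ k, n = k + 1 := ⟨n - 1, by omega⟩
  have step : ∀ n, (σ ^ (n + 1)) x = (σ ^ n) (σ x) := fun n => by
    rw [pow_succ, AlgEquiv.mul_apply]
  have hx1 : σ x ≠ 0 := by simpa using hx
  apply le_antisymm
  · by_contra! h
    have key : ∀ k : ℕ, w x < w ((σ ^ (k + 1)) x) := by
      intro k
      induction k with
      | zero => simpa using h
      | succ k ih =>
        refine ih.trans (not_le.1 ?_)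
        rw [step (k + 1), hmono (σ ^ (k + 1)) x (σ x) hx1]
        exact not_le.2 h
    exact absurd (key n) (by rw [hσ]; exact lt_irrefl _)
  · by_contra! h
    have key : ∀ k : ℕ, w ((σ ^ (k + 1)) x) < w x := by
      intro k
      induction k with
      | zero => simpa using h
      | succ k ih =>
        refine lt_trans (not_le.1 ?_) ih
        rw [step (k + 1), hmono (σ ^ (k + 1)) (σ x) x hx]
        exact not_le.2 h
    exact absurd (key n) (by rw [hσ]; exact lt_irrefl _)

end Invariance

/-! ### Comparing degrees through stabilizers of conjugates -/

section Conjugates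

variable {K E : Type*} [Field K] [Field E] [Algebra K E]

theorem ncard_rootSet_le_deg (a : E) : ((minpoly K a).rootSet E).ncard ≤ deg K a := by
  classical
  rw [Polynomial.rootSet_def, Set.ncard_coe_finset]
  refine (Multiset.toFinset_card_le _).trans ((Polynomial.card_roots' _).trans ?_)
  exact Polynomial.natDegree_map_le

theorem exists_conjugate_map {a b : E} (h : ∀ σ : E ≃ₐ[K] E, σ a = a → σ b = b) :
    ∃ f : E → E, ∀ σ : E ≃ₐ[K] E, f (σ a) = σ b := by
  classical
  refine ⟨fun x => if hx : ∃ σ : E ≃ₐ[K] E, σ a = x then hx.choose b else 0, fun σ => ?_⟩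
  have hx : ∃ τ : E ≃ₐ[K] E, τ a = σ a := ⟨σ, rfl⟩
  simp only [dif_pos hx]
  have h1 : (σ⁻¹ * hx.choose) b = b := h _ (by
    rw [AlgEquiv.mul_apply, hx.choose_spec, ← AlgEquiv.mul_apply, inv_mul_cancel, AlgEquiv.one_apply])
  have h2 := congrArg σ h1
  rwa [← AlgEquiv.mul_apply, mul_inv_cancel_left] at h2

variable [Normal K E]

theorem mem_rootSet_minpoly_iff {a b : E} :
    b ∈ (minpoly K a).rootSet E ↔ ∃ σ : E ≃ₐ[K] E, σ a = b := by
  have ha : IsIntegral K a := Normal.isIntegral inferInstance a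
  constructor
  · intro h
    exact minpoly.exists_algEquiv_of_root' ha.isAlgebraic ((Polynomial.mem_rootSet.1 h).2)
  · rintro ⟨σ, rfl⟩
    rw [Polynomial.mem_rootSet]
    exact ⟨minpoly.ne_zero ha, by rw [Polynomial.aeval_algHom_apply, minpoly.aeval, map_zero]⟩

theorem ncard_rootSet_eq_deg {a : E} (ha : IsSeparable K a) :
    ((minpoly K a).rootSet E).ncard = deg K a := by
  rw [← Nat.card_coe_set_eq, Nat.card_eq_fintype_card]
  exact Polynomial.card_rootSet_eq_natDegree ha (Normal.splits inferInstance a)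

theorem image_rootSet_of_map {a b : E} {f : E → E} (hf : ∀ σ : E ≃ₐ[K] E, f (σ a) = σ b) :
    f '' (minpoly K a).rootSet E = (minpoly K b).rootSet E := by
  ext y
  simp only [Set.mem_image, mem_rootSet_minpoly_iff]
  constructor
  · rintro ⟨_, ⟨σ, rfl⟩, rfl⟩
    exact ⟨σ, (hf σ).symm⟩
  · rintro ⟨σ, rfl⟩
    exact ⟨_, ⟨σ, rfl⟩, hf σ⟩

theorem deg_le_of_stabilizer_le {a b : E} (hb : IsSeparable K b)
    (h : ∀ σ : E ≃ₐ[K] E, σ a = a → σ b = b) : deg K b ≤ deg K a := by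
  obtain ⟨f, hf⟩ := exists_conjugate_map h
  rw [← ncard_rootSet_eq_deg hb, ← image_rootSet_of_map hf]
  exact (Set.ncard_image_le (Polynomial.rootSet_finite _ _)).trans (ncard_rootSet_le_deg a)

/-- The map `σ a ↦ σ b` from conjugates of `a` onto those of `b` is not injective, since `τ a` and
`a` both go to `b`. Separability of `b` turns its number of conjugates into its degree. -/
theorem deg_lt_of_stabilizer_lt {a b : E} (hb : IsSeparable K b)
    (h : ∀ σ : E ≃ₐ[K] E, σ a = a → σ b = b) {τ : E ≃ₐ[K] E} (hτb : τ b = b) (hτa : τ a ≠ a) :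
    deg K b < deg K a := by
  obtain ⟨f, hf⟩ := exists_conjugate_map h
  rw [← ncard_rootSet_eq_deg hb, ← image_rootSet_of_map hf]
  have hfin : ((minpoly K a).rootSet E).Finite := Polynomial.rootSet_finite _ _
  refine lt_of_lt_of_le ((Set.ncard_image_le hfin).lt_of_ne fun he => hτa ?_) (ncard_rootSet_le_deg a)
  refine Set.injOn_of_ncard_image_eq he hfin (mem_rootSet_minpoly_iff.2 ⟨τ, rfl⟩)
    (mem_rootSet_minpoly_iff.2 ⟨1, rfl⟩) ?_
  have h1 := hf 1
  rw [AlgEquiv.one_apply, AlgEquiv.one_apply] at h1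
  rw [hf, hτb, h1]

end Conjugates

/-! ### An element of smaller degree from an integral element of unit trace -/

section TraceElement

variable {Γ : Type*} [AddCommGroup Γ] [LinearOrder Γ] [IsOrderedAddMonoid Γ]
variable {K E : Type*} [Field K] [Field E] [Algebra K E] [Normal K E]

theorem exists_algEquiv_comp_val {L : IntermediateField K E} (φ : L →ₐ[K] E) :
    ∃ σ : E ≃ₐ[K] E, ∀ x : L, φ x = σ x := by
  let ψ := φ.liftNormal E
  refine ⟨AlgEquiv.ofBijective ψ (AlgHom.normal_bijective K E E ψ), fun x => ?_⟩
  exact (φ.liftNormal_commutes E x).symm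

/-- The sum of `φ x` over the embeddings `φ` that move `g` into the ball of radius `γ`
around `b`. -/
noncomputable def ballSum (w : AddValuation E (WithTop Γ)) {L : IntermediateField K E}
    [FiniteDimensional K L] (γ : WithTop Γ) (g : L) (b : E) (x : L) : E :=
  open Classical in ∑ φ : L →ₐ[K] E with γ ≤ w (b - φ g), φ x

variable {w : AddValuation E (WithTop Γ)} {L : IntermediateField K E} [FiniteDimensional K L]

omit [Normal K E] in
theorem ballSum_map (hw : ∀ (σ : E ≃ₐ[K] E) (x : E), w (σ x) = w x) (γ : WithTop Γ) (g : L) (b : E)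
    (x : L) (σ : E ≃ₐ[K] E) : ballSum w γ g (σ b) x = σ (ballSum w γ g b x) := by
  classical
  unfold ballSum
  rw [map_sum]
  refine Finset.sum_nbij' (fun φ => (σ⁻¹ : E ≃ₐ[K] E).toAlgHom.comp φ)
    (fun φ => σ.toAlgHom.comp φ) ?_ ?_ ?_ ?_ ?_
  · intro φ hφ
    simp only [Finset.mem_filter, Finset.mem_univ, true_and] at hφ ⊢
    rw [← hw σ]
    simpa using hφ
  · intro φ hφ
    simp only [Finset.mem_filter, Finset.mem_univ, true_and] at hφ ⊢
    rw [← hw σ] at hφ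
    simpa using hφ
  · intro φ _
    ext x
    simp
  · intro φ _
    ext x
    simp
  · intro φ _
    simp

-- Any point of an ultrametric ball is a centre of it.
omit [Normal K E] in
theorem ballSum_congr {γ : WithTop Γ} {b b' : E} (h : γ ≤ w (b - b')) (g x : L) :
    ballSum w γ g b x = ballSum w γ g b' x := by
  classical
  unfold ballSum
  congr 1
  ext φ
  simp only [Finset.mem_filter, Finset.mem_univ, true_and]
  constructor
  · intro h'
    have := w.map_le_sub h' h
    rwa [sub_sub_sub_cancel_left] at this
  · intro h'
    have := w.map_le_add h h'
    rwa [sub_add_sub_cancel] at this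

/-- The balls of radius `γ` partition the embeddings, and every partial sum is an automorphic image
of the one around `g`, so all of them have the same value. -/
theorem sum_embeddings_pos (hw : ∀ (σ : E ≃ₐ[K] E) (x : E), w (σ x) = w x) {γ : WithTop Γ} {g x : L}
    (h : 0 < w (ballSum w γ g g x)) : 0 < w (∑ φ : L →ₐ[K] E, φ x) := by
  classical
  let R : Setoid (L →ₐ[K] E) :=
    { r := fun φ ψ => γ ≤ w (φ g - ψ g)
      iseqv :=
        { refl := fun φ => by simp
          symm := fun h => by rwa [w.map_sub_swap]
          trans := fun h h' => by simpa using w.map_le_add h h' } }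
  rw [Finset.sum_partition R]
  refine w.map_lt_sum' (by simp) fun q _ => ?_
  obtain ⟨ψ, rfl⟩ := Quotient.exists_rep q
  obtain ⟨σ, hσ⟩ := exists_algEquiv_comp_val ψ
  have : ∑ φ : L →ₐ[K] E with (Quotient.mk R φ = Quotient.mk R ψ), φ x
      = ballSum w γ g (σ g) x := by
    unfold ballSum
    congr 1
    ext φ
    simp only [Finset.mem_filter, Finset.mem_univ, true_and]
    rw [Quotient.eq, ← hσ, w.map_sub_swap]
    exact Iff.rfl
  refine lt_of_lt_of_eq ?_ (congrArg w this.symm)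
  rwa [ballSum_map hw, hw]

theorem exists_deg_lt_of_trace [IsAlgClosed E] (hw : ∀ (σ : E ≃ₐ[K] E) (x : E), w (σ x) = w x)
    {a : E} (ha : IsSeparable K a) {c : K⟮a⟯} (hc : 0 ≤ w c)
    (htr : w (algebraMap K E (Algebra.trace K K⟮a⟯ c)) = 0) {τ : E ≃ₐ[K] E} (hτ : τ a ≠ a) :
    ∃ β : E, deg K β < deg K a ∧ w (a - τ a) ≤ w (a - β) := by
  classical
  have hint : IsIntegral K a := ha.isIntegral
  have : FiniteDimensional K K⟮a⟯ := IntermediateField.adjoin.finiteDimensional hint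
  have : Algebra.IsSeparable K K⟮a⟯ :=
    (IntermediateField.isSeparable_adjoin_simple_iff_isSeparable K E).2 ha
  set γ := w (a - τ a) with hγ
  let g : K⟮a⟯ := IntermediateField.AdjoinSimple.gen K a
  set S : K⟮a⟯ → E := ballSum w γ g a with hS
  have hφint : ∀ (φ : K⟮a⟯ →ₐ[K] E) (x : K⟮a⟯), w (φ x) = w x := fun φ x => by
    obtain ⟨σ, hσ⟩ := exists_algEquiv_comp_val φ
    rw [hσ, hw]
  have hu : w (S c) = 0 := by
    refine le_antisymm (not_lt.1 fun h => ?_)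
      (w.map_le_sum fun φ _ => by rw [hφint]; exact hc)
    have := sum_embeddings_pos (g := g) hw h
    rw [← trace_eq_sum_embeddings, htr] at this
    exact lt_irrefl _ this
  have hu0 : S c ≠ 0 := fun h => by simp [h] at hu
  have hsepS : ∀ x, IsSeparable K (S x) := by
    intro x
    rw [← mem_separableClosure_iff]
    refine sum_mem fun φ _ => ?_
    rw [mem_separableClosure_iff]
    exact (Algebra.IsSeparable.isSeparable K x).map φ φ.injective
  have hfix : ∀ σ : E ≃ₐ[K] E, γ ≤ w (a - σ a) → ∀ x, σ (S x) = S x := by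
    intro σ hσ x
    rw [hS, ← ballSum_map hw]
    exact (ballSum_congr hσ g x).symm
  -- The mean of the conjugates of `a` in its ball, weighted by the conjugates of `c`; weights with
  -- unit sum replace a division by the number of conjugates.
  refine ⟨S (c * g) / S c, deg_lt_of_stabilizer_lt ?_ ?_ (τ := τ) ?_ hτ, ?_⟩
  · rw [← mem_separableClosure_iff]
    exact div_mem (mem_separableClosure_iff.2 (hsepS _)) (mem_separableClosure_iff.2 (hsepS _))
  · intro σ hσ
    rw [map_div₀, hfix σ (by simp [hσ]), hfix σ (by simp [hσ])]
  · rw [map_div₀, hfix τ le_rfl, hfix τ le_rfl]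
  · have h1 : a - S (c * g) / S c = (a * S c - S (c * g)) / S c := by
      field_simp
    have h2 : γ ≤ w (a * S c - S (c * g)) := by
      simp only [hS, ballSum]
      rw [Finset.mul_sum, ← Finset.sum_sub_distrib]
      refine w.map_le_sum fun φ hφ => ?_
      have : a * φ c - φ (c * g) = φ c * (a - φ g) := by rw [map_mul]; ring
      rw [this, w.map_mul, hφint]
      simp only [Finset.mem_filter, Finset.mem_univ, true_and] at hφ
      calc γ ≤ w (a - φ g) := hφ
        _ = 0 + w (a - φ g) := (zero_add _).symm
        _ ≤ _ := by gcongr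
    rw [h1, w.map_div, hu]
    simpa using h2

end TraceElement

/-! ### Calculus of residue classes -/

section Residue

variable {Γ : Type*} [AddCommGroup Γ] [LinearOrder Γ] [IsOrderedAddMonoid Γ]
variable {E : Type*} [Field E] (w : AddValuation E (WithTop Γ))

/-- The residue class of an integral element, extended by `0` to non-integral elements. -/
noncomputable def res (x : E) : IsLocalRing.ResidueField (valuationRing w) :=
  open Classical in if h : 0 ≤ w x then IsLocalRing.residue (valuationRing w) ⟨x, h⟩ else 0

variable {w}

theorem res_of_nonneg {x : E} (h : 0 ≤ w x) :
    res w x = IsLocalRing.residue (valuationRing w) ⟨x, h⟩ := dif_pos h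

theorem isUnit_valuationRing_iff {x : E} (h : 0 ≤ w x) :
    IsUnit (⟨x, h⟩ : valuationRing w) ↔ w x = 0 := by
  constructor
  · intro hu
    obtain ⟨y, hy⟩ := isUnit_iff_exists_inv.1 hu
    have h1 : w x + w y = 0 := by
      rw [← w.map_mul, ← w.map_one]
      exact congrArg w (congrArg Subtype.val hy)
    have hy0 : 0 ≤ w y := y.2
    refine le_antisymm ?_ h
    rw [← h1]
    exact le_add_of_nonneg_right hy0
  · intro h0
    have hx : x ≠ 0 := fun hx => by simp [hx] at h0
    have hi : 0 ≤ w x⁻¹ := by simp [w.map_inv, h0]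
    exact isUnit_iff_exists_inv.2 ⟨⟨x⁻¹, hi⟩, Subtype.ext (mul_inv_cancel₀ hx)⟩

theorem res_eq_zero_iff {x : E} (h : 0 ≤ w x) : res w x = 0 ↔ 0 < w x := by
  rw [res_of_nonneg h, IsLocalRing.residue_eq_zero_iff, IsLocalRing.mem_maximalIdeal,
    mem_nonunits_iff, isUnit_valuationRing_iff, h.lt_iff_ne, ne_comm]

theorem res_add {x y : E} (hx : 0 ≤ w x) (hy : 0 ≤ w y) : res w (x + y) = res w x + res w y := by
  rw [res_of_nonneg hx, res_of_nonneg hy, res_of_nonneg (w.map_le_add hx hy), ← map_add]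
  rfl

theorem res_sub {x y : E} (hx : 0 ≤ w x) (hy : 0 ≤ w y) : res w (x - y) = res w x - res w y := by
  rw [res_of_nonneg hx, res_of_nonneg hy, res_of_nonneg (w.map_le_sub hx hy), ← map_sub]
  rfl

theorem nonneg_mul {x y : E} (hx : 0 ≤ w x) (hy : 0 ≤ w y) : 0 ≤ w (x * y) := by
  rw [w.map_mul]
  exact add_nonneg hx hy

theorem res_mul {x y : E} (hx : 0 ≤ w x) (hy : 0 ≤ w y) : res w (x * y) = res w x * res w y := by
  rw [res_of_nonneg hx, res_of_nonneg hy, res_of_nonneg (nonneg_mul hx hy), ← map_mul]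
  rfl

theorem res_sum {ι : Type*} (s : Finset ι) {f : ι → E} (hf : ∀ i, 0 ≤ w (f i)) :
    res w (∑ i ∈ s, f i) = ∑ i ∈ s, res w (f i) := by
  classical
  induction s using Finset.induction_on with
  | empty => simpa using (res_eq_zero_iff (w := w) (x := 0) (by simp)).2 (by simp)
  | insert a s ha ih =>
    rw [Finset.sum_insert ha, Finset.sum_insert ha, res_add (hf a) (w.map_le_sum fun i _ => hf i), ih]

theorem mem_residueField_iff {K : Type*} [Field K] [Algebra K E] {L : IntermediateField K E}
    {c : IsLocalRing.ResidueField (valuationRing w)} :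
    c ∈ residueField w L ↔ ∃ x ∈ L, 0 ≤ w x ∧ res w x = c := by
  constructor
  · rintro ⟨x, hx, rfl⟩
    exact ⟨x, hx, x.2, res_of_nonneg x.2⟩
  · rintro ⟨x, hx, h, rfl⟩
    exact ⟨⟨x, h⟩, hx, (res_of_nonneg h).symm⟩

theorem mem_residueField_bot_iff {K : Type*} [Field K] [Algebra K E]
    {c : IsLocalRing.ResidueField (valuationRing w)} :
    c ∈ residueField w (⊥ : IntermediateField K E) ↔
      ∃ a : K, 0 ≤ w (algebraMap K E a) ∧ res w (algebraMap K E a) = c := by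
  rw [mem_residueField_iff]
  simp [IntermediateField.mem_bot]

end Residue

/-! ### Valuation independence of the products `x i * z j` -/

section ValuationIndependence

variable {Γ : Type*} [AddCommGroup Γ] [LinearOrder Γ] [IsOrderedAddMonoid Γ]
variable {K E : Type*} [Field K] [Field E] [Algebra K E] {w : AddValuation E (WithTop Γ)}
variable {ι κ : Type*} [Fintype ι] [Fintype κ]

local notation "k₀" => residueField w (⊥ : IntermediateField K E)

theorem map_sum_eq_zero_of_linearIndependent {z : κ → E} (hz : ∀ j, 0 ≤ w (z j))
    (hli : LinearIndependent k₀ fun j => res w (z j))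
    {a : κ → K} (ha : ∀ j, 0 ≤ w (algebraMap K E (a j))) {j₀ : κ}
    (hj₀ : w (algebraMap K E (a j₀)) = 0) : w (∑ j, algebraMap K E (a j) * z j) = 0 := by
  have hterm : ∀ j, 0 ≤ w (algebraMap K E (a j) * z j) := fun j => nonneg_mul (ha j) (hz j)
  have hsum : 0 ≤ w (∑ j, algebraMap K E (a j) * z j) := w.map_le_sum fun j _ => hterm j
  refine le_antisymm (not_lt.1 fun h => ?_) hsum
  rw [← res_eq_zero_iff hsum, res_sum _ hterm] at h
  have h0 := Fintype.linearIndependent_iff.1 hli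
    (fun j => ⟨res w (algebraMap K E (a j)), mem_residueField_bot_iff.2 ⟨_, ha j, rfl⟩⟩) (by
      rw [← h]
      refine Finset.sum_congr rfl fun j _ => ?_
      rw [res_mul (ha j) (hz j)]
      rfl) j₀
  have h1 : res w (algebraMap K E (a j₀)) = 0 := congrArg Subtype.val h0
  rw [res_eq_zero_iff (ha j₀), hj₀] at h1
  exact lt_irrefl _ h1

theorem exists_map_sum_eq [Nonempty κ] {z : κ → E} (hz : ∀ j, 0 ≤ w (z j))
    (hli : LinearIndependent k₀ fun j => res w (z j)) (a : κ → K) :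
    ∃ j₀, w (∑ j, algebraMap K E (a j) * z j) = w (algebraMap K E (a j₀)) ∧
      ∀ j, w (algebraMap K E (a j₀)) ≤ w (algebraMap K E (a j)) := by
  obtain ⟨j₀, hj₀⟩ := Finite.exists_min fun j => w (algebraMap K E (a j))
  refine ⟨j₀, ?_, hj₀⟩
  by_cases h0 : a j₀ = 0
  · have : ∀ j, a j = 0 := fun j => by
      have := hj₀ j
      rw [h0, map_zero, w.map_zero, top_le_iff, w.top_iff] at this
      simpa using this
    simp [this]
  have h0' : algebraMap K E (a j₀) ≠ 0 := by simpa using h0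
  have h1 : ∑ j, algebraMap K E (a j) * z j
      = algebraMap K E (a j₀) * ∑ j, algebraMap K E (a j / a j₀) * z j := by
    rw [Finset.mul_sum]
    refine Finset.sum_congr rfl fun j _ => ?_
    rw [map_div₀]
    field_simp
  rw [h1, w.map_mul, map_sum_eq_zero_of_linearIndependent hz hli (j₀ := j₀), add_zero]
  · intro j
    rw [map_div₀]
    exact (div_mem_valuationRing_iff h0').2 (hj₀ j)
  · rw [div_self h0, map_one, w.map_one]

/-- For fixed `i`, independence of the residues forbids cancellation among the `z j`. For different
`i` the values lie in different cosets of the value group of `K`, so the minimum is attained only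
once. -/
theorem map_sum_le_of_independent {x : ι → E} {z : κ → E}
    (hx : ∀ (i i' : ι) (a b : K), a ≠ 0 →
      w (algebraMap K E a * x i) = w (algebraMap K E b * x i') → i = i')
    (hz : ∀ j, 0 ≤ w (z j)) (hli : LinearIndependent k₀ fun j => res w (z j))
    (a : ι → κ → K) (i : ι) (j : κ) :
    w (∑ i, ∑ j, algebraMap K E (a i j) * (x i * z j)) ≤ w (algebraMap K E (a i j) * x i) := by
  classical
  have : Nonempty κ := ⟨j⟩
  have : Nonempty ι := ⟨i⟩
  have h1 : ∀ i, ∑ j, algebraMap K E (a i j) * (x i * z j)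
      = (∑ j, algebraMap K E (a i j) * z j) * x i := fun i => by
    rw [Finset.sum_mul]
    exact Finset.sum_congr rfl fun j _ => by ring
  simp_rw [h1]
  choose m hm hm' using fun i => exists_map_sum_eq hz hli (a i)
  set y : ι → E := fun i => (∑ j, algebraMap K E (a i j) * z j) * x i with hy
  have hy' : ∀ i, w (y i) = w (algebraMap K E (a i (m i)) * x i) := fun i => by
    rw [hy]
    simp only [w.map_mul, hm]
  obtain ⟨i₀, hi₀⟩ := Finite.exists_min fun i => w (y i)
  have h2 : w (y i) ≤ w (algebraMap K E (a i j) * x i) := by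
    rw [hy', w.map_mul, w.map_mul]
    gcongr
    exact hm' i j
  refine le_trans ?_ ((hi₀ i).trans h2)
  by_cases htop : w (y i₀) = ⊤
  · rw [htop]
    exact le_top
  have ha : a i₀ (m i₀) ≠ 0 := fun h => htop (by rw [hy', h]; simp)
  rw [← Finset.add_sum_erase _ _ (Finset.mem_univ i₀)]
  refine (w.map_add_eq_of_lt_left ?_).le
  refine w.map_lt_sum htop fun i' hi' => (hi₀ i').lt_of_ne fun he => (Finset.ne_of_mem_erase hi') ?_
  rw [hy', hy'] at he
  exact (hx _ _ _ _ ha he).symm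

end ValuationIndependence

/-! ### An integral element of unit trace in a tame extension -/

section Trace

variable {Γ : Type*} [AddCommGroup Γ] [LinearOrder Γ] [IsOrderedAddMonoid Γ]
variable {K E : Type*} [Field K] [Field E] [Algebra K E] {w : AddValuation E (WithTop Γ)}
variable {L : IntermediateField K E}

theorem linearIndependent_mul {ι κ : Type*} [Fintype ι] [Fintype κ] {x : ι → L} {z : κ → L}
    (hmin : ∀ (a : ι → κ → K) i j, w (∑ i, ∑ j, algebraMap K E (a i j) * (x i * z j))
      ≤ w (algebraMap K E (a i j) * x i))
    (hx0 : ∀ i, x i ≠ 0) : LinearIndependent K fun p : ι × κ => x p.1 * z p.2 := by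
  rw [Fintype.linearIndependent_iff]
  intro g hg p
  have h1 := hmin (fun i j => g (i, j)) p.1 p.2
  have h2 : ∑ i, ∑ j, algebraMap K E (g (i, j)) * ((x i : E) * z j) = 0 := by
    have := congrArg (algebraMap L E) hg
    rw [Fintype.sum_prod_type, map_zero] at this
    rw [← this]
    simp [Algebra.smul_def]
  rw [h2, w.map_zero, top_le_iff, w.top_iff, mul_eq_zero] at h1
  simpa [hx0] using h1

/-- Modulo the maximal ideal, the diagonal of multiplication by `c` in the basis `x i * z j` is one
copy of the diagonal of `m` for each `i`. -/
theorem trace_sub_pos {ι κ : Type*} [Fintype ι] [Fintype κ] {x : ι → L} {z : κ → L}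
    (hmin : ∀ (a : ι → κ → K) i j, w (∑ i, ∑ j, algebraMap K E (a i j) * (x i * z j))
      ≤ w (algebraMap K E (a i j) * x i))
    (hx0 : ∀ i, x i ≠ 0) (b : Module.Basis (ι × κ) K L) (hb : ∀ i j, b (i, j) = x i * z j)
    (c : L) (m : κ → κ → K)
    (hm : ∀ j, 0 < w (c * z j - ∑ k, algebraMap K E (m j k) * z k)) :
    0 < w (algebraMap K E (Algebra.trace K L c) -
      ∑ _i : ι, ∑ j : κ, algebraMap K E (m j j)) := by
  classical
  rw [Algebra.trace_eq_matrix_trace b, Matrix.trace, Fintype.sum_prod_type, map_sum,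
    ← Finset.sum_sub_distrib]
  refine w.map_lt_sum' (by simp) fun i _ => ?_
  rw [map_sum, ← Finset.sum_sub_distrib]
  refine w.map_lt_sum' (by simp) fun j _ => ?_
  rw [Matrix.diag_apply, Algebra.leftMulMatrix_eq_repr_mul]
  -- These are the coordinates of `(c * z j - ∑ k, m j k * z k) * x i`; valuation independence
  -- bounds the `(i, j)` one, and the factor `x i` cancels.
  have h1 := hmin (fun i' j' => b.repr (c * b (i, j)) (i', j') - if i' = i then m j j' else 0) i j
  have h2 : (∑ i', ∑ j', algebraMap K E
      (b.repr (c * b (i, j)) (i', j') - if i' = i then m j j' else 0) * ((x i' : E) * z j'))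
      = (c * z j - ∑ k, algebraMap K E (m j k) * z k) * x i := by
    have h3 := congrArg (algebraMap L E) (b.sum_repr (c * b (i, j)))
    rw [Fintype.sum_prod_type] at h3
    simp only [map_sum, Algebra.smul_def, map_mul, hb, ← IsScalarTower.algebraMap_apply] at h3
    simp only [map_sub, sub_mul, Finset.sum_sub_distrib]
    have h4 : ∀ t : L, algebraMap L E t = t := fun _ => rfl
    simp only [h4] at h3
    rw [hb, h3]
    have h5 : ∀ i', ∑ j', algebraMap K E (if i' = i then m j j' else 0) * ((x i' : E) * z j')
        = if i' = i then (∑ j', algebraMap K E (m j j') * z j') * x i else 0 := by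
      intro i'
      split_ifs with h
      · subst h
        rw [Finset.sum_mul]
        exact Finset.sum_congr rfl fun _ _ => by ring
      · simp
    simp only [h5, Finset.sum_ite_eq', Finset.mem_univ, if_true]
    ring
  rw [h2, w.map_mul, w.map_mul] at h1
  have hx : w (x i : E) ≠ ⊤ := w.ne_top_iff.2 (by simpa using hx0 i)
  have h3 := (WithTop.add_le_add_iff_right hx).1 h1
  rw [if_pos rfl, RingHom.map_sub] at h3
  exact (hm j).trans_le h3

theorem residueField_mono {L' : IntermediateField K E} (h : L ≤ L') :
    residueField w L ≤ residueField w L' := by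
  rintro _ ⟨x, hx, rfl⟩
  exact ⟨x, h hx, rfl⟩

theorem exists_valueGroup_representatives (w : AddValuation E (WithTop Γ))
    (L : IntermediateField K E) (he : ramificationIndex w L ≠ 0) :
    ∃ x : Fin (ramificationIndex w L) → L, (∀ i, x i ≠ 0) ∧
      ∀ (i i' : Fin (ramificationIndex w L)) (a b : K), a ≠ 0 →
        w (algebraMap K E a * x i) = w (algebraMap K E b * x i') → i = i' := by
  let Q := valueGroup w L ⧸ (valueGroup w (⊥ : IntermediateField K E)).addSubgroupOf (valueGroup w L)
  have hcard : Nat.card Q = ramificationIndex w L := rfl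
  have : Finite Q := Nat.finite_of_card_ne_zero (by rwa [hcard])
  let e : Fin (ramificationIndex w L) ≃ Q := (Finite.equivFinOfCardEq hcard).symm
  choose x hxL hx using fun i => (e i).out.2
  refine ⟨fun i => ⟨x i, hxL i⟩, fun i h => ?_, fun i i' a b ha h => ?_⟩
  · have := hx i
    rw [show x i = 0 from congrArg Subtype.val h, w.map_zero] at this
    exact WithTop.top_ne_coe this
  · apply e.injective
    rw [← QuotientAddGroup.out_eq' (e i), ← QuotientAddGroup.out_eq' (e i'), QuotientAddGroup.eq,
      AddSubgroup.mem_addSubgroupOf]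
    have hb : b ≠ 0 := fun hb => by
      rw [hb, map_zero, zero_mul, w.map_zero, w.top_iff, mul_eq_zero] at h
      have hxi : x i ≠ 0 := fun h' => by simpa [h'] using hx i
      simp [ha, hxi] at h
    refine ⟨algebraMap K E (a / b), IntermediateField.algebraMap_mem _ _, ?_⟩
    simp only [w.map_mul, hx] at h
    have hb' : w (algebraMap K E b) ≠ ⊤ := w.ne_top_iff.2 (by simpa using hb)
    have ha' : w (algebraMap K E a) ≠ ⊤ := w.ne_top_iff.2 (by simpa using ha)
    obtain ⟨β, hβ⟩ := WithTop.ne_top_iff_exists.1 hb'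
    obtain ⟨α, hα⟩ := WithTop.ne_top_iff_exists.1 ha'
    rw [map_div₀, w.map_div, ← hα, ← hβ]
    rw [← hα, ← hβ] at h
    norm_cast at h ⊢
    simp only [AddSubgroup.coe_add, AddSubgroup.coe_neg]
    rw [neg_add_eq_sub, sub_eq_sub_iff_add_eq_add, h, add_comm]

/-- This covers residue characteristic zero too, where not being divisible by `0` means being
nonzero. -/
theorem IsTame.natCast_ramificationIndex_ne_zero (h : IsTame w L) :
    (ramificationIndex w L : residueField w (⊥ : IntermediateField K E)) ≠ 0 := fun h0 =>
  h.not_dvd (ringChar.dvd h0)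

theorem IsTame.ramificationIndex_ne_zero [FiniteDimensional K L] (h : IsTame w L) :
    ramificationIndex w L ≠ 0 := fun h0 => by
  have := h.defectless
  rw [IsDefectless, h0, zero_mul] at this
  exact Module.finrank_pos.ne' this

theorem IsTame.inertiaDegree_ne_zero [FiniteDimensional K L] (h : IsTame w L) :
    inertiaDegree w L ≠ 0 := fun h0 => by
  have := h.defectless
  rw [IsDefectless, h0, mul_zero] at this
  exact Module.finrank_pos.ne' this

theorem IsTame.exists_residue_matrix [FiniteDimensional K L] (h : IsTame w L) :
    ∃ (z : Fin (inertiaDegree w L) → L) (c : L)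
      (m : Fin (inertiaDegree w L) → Fin (inertiaDegree w L) → K),
      (∀ j, 0 ≤ w (z j)) ∧
      (LinearIndependent (residueField w (⊥ : IntermediateField K E)) fun j => res w (z j : E)) ∧
      0 ≤ w c ∧ (∀ j k, 0 ≤ w (algebraMap K E (m j k))) ∧
      (∀ j, 0 < w (c * z j - ∑ k, algebraMap K E (m j k) * z k)) ∧
      ∑ j, res w (algebraMap K E (m j j)) = 1 := by
  classical
  set k₀ := residueField w (⊥ : IntermediateField K E) with hk₀
  have hle : k₀ ≤ residueField w L := residueField_mono bot_le
  let k₁ : IntermediateField k₀ (IsLocalRing.ResidueField (valuationRing w)) :=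
    Subfield.extendScalars hle
  have hfin : Module.finrank k₀ k₁ = inertiaDegree w L :=
    (Subfield.relfinrank_eq_finrank_of_le hle).symm
  have : FiniteDimensional k₀ k₁ := Module.finite_of_finrank_pos
    (hfin ▸ Nat.pos_of_ne_zero h.inertiaDegree_ne_zero)
  have : Algebra.IsSeparable k₀ k₁ := ⟨fun c => by
    have := h.residue_separable c c.2
    rw [IsSeparable, ← minpoly.algebraMap_eq
      (algebraMap k₁ (IsLocalRing.ResidueField (valuationRing w))).injective c]
    exact this⟩
  let ζ : Module.Basis (Fin (inertiaDegree w L)) k₀ k₁ := Module.finBasisOfFinrankEq k₀ k₁ hfin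
  choose z hzL hz hzres using fun j => mem_residueField_iff.1 (ζ j).2
  -- Here separability of the residue extension enters.
  obtain ⟨t, ht⟩ := Algebra.trace_surjective k₀ k₁ 1
  obtain ⟨c, hcL, hc, hct⟩ := mem_residueField_iff.1 t.2
  choose m hm hmres using fun j k => mem_residueField_bot_iff.1 (ζ.repr (t * ζ j) k).2
  refine ⟨fun j => ⟨z j, hzL j⟩, ⟨c, hcL⟩, m, hz, ?_, hc, hm, fun j => ?_, ?_⟩
  · simp_rw [hzres]
    exact ζ.linearIndependent.map' k₁.val.toLinearMap (LinearMap.ker_eq_bot.2 k₁.val.injective)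
  · have hsum : 0 ≤ w (∑ k, algebraMap K E (m j k) * z k) :=
      w.map_le_sum fun k _ => nonneg_mul (hm j k) (hz k)
    have hcz := nonneg_mul hc (hz j)
    rw [← res_eq_zero_iff (w.map_le_sub hcz hsum), res_sub hcz hsum,
      res_sum _ fun k => nonneg_mul (hm j k) (hz k), res_mul hc (hz j), hct, hzres, sub_eq_zero]
    have := congrArg (algebraMap k₁ (IsLocalRing.ResidueField (valuationRing w)))
      (ζ.sum_repr (t * ζ j))
    rw [RingHom.map_mul, map_sum] at this
    refine this.symm.trans (Finset.sum_congr rfl fun k _ => ?_)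
    rw [res_mul (hm j k) (hz k), hmres, hzres]
    rfl
  · have h1 : ∑ j, ζ.repr (t * ζ j) j = 1 := by
      rw [← ht, Algebra.trace_eq_matrix_trace ζ]
      simp [Matrix.trace, Algebra.leftMulMatrix_eq_repr_mul]
    simp_rw [hmres]
    have h2 := congrArg k₀.subtype h1
    rw [map_sum] at h2
    exact h2

theorem IsTame.exists_trace_eq_zero [FiniteDimensional K L] (h : IsTame w L) :
    ∃ c : L, 0 ≤ w c ∧ w (algebraMap K E (Algebra.trace K L c)) = 0 := by
  classical
  obtain ⟨x, hx0, hx⟩ := exists_valueGroup_representatives w L h.ramificationIndex_ne_zero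
  obtain ⟨z, c, m, hz, hli, hc, hm, hdiff, hsum⟩ := h.exists_residue_matrix
  have hmin := map_sum_le_of_independent hx hz hli
  have : NeZero (ramificationIndex w L) := ⟨h.ramificationIndex_ne_zero⟩
  have : NeZero (inertiaDegree w L) := ⟨h.inertiaDegree_ne_zero⟩
  -- Defectlessness is what makes the `e * f` independent products a basis.
  let b := basisOfLinearIndependentOfCardEqFinrank (linearIndependent_mul hmin hx0)
    (by simpa using h.defectless.symm)
  have htr := trace_sub_pos hmin hx0 b (fun i j => by simp [b]) c m hdiff
  set S := ∑ _i : Fin (ramificationIndex w L), ∑ j, algebraMap K E (m j j) with hS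
  have hS0 : 0 ≤ w S := w.map_le_sum fun _ _ => w.map_le_sum fun j _ => hm j j
  have hSres : res w S ≠ 0 := by
    rw [hS, res_sum _ fun _ => w.map_le_sum fun j _ => hm j j, res_sum _ fun j => hm j j, hsum,
      Finset.sum_const, Finset.card_univ, Fintype.card_fin, nsmul_eq_mul, mul_one]
    exact fun h0 => h.natCast_ramificationIndex_ne_zero
      (Subtype.val_injective ((map_natCast (residueField w (⊥ : IntermediateField K E)).subtype _).trans h0))
  have hwS : w S = 0 := le_antisymm (not_lt.1 fun h => hSres ((res_eq_zero_iff hS0).2 h)) hS0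
  exact ⟨c, hc, hwS ▸ w.map_eq_of_lt_sub (by rwa [hwS])⟩

end Trace

/-! ### Krasner's constant, the main invariant and Okutsu sequences -/

section MainInvariant

variable {Γ : Type*} [AddCommGroup Γ] [LinearOrder Γ] [IsOrderedAddMonoid Γ]
variable {K E : Type*} [Field K] [Field E] [Algebra K E] {w : AddValuation E (WithTop Γ)}

theorem IsTame.isSeparable {a : E} (h : IsTame w K⟮a⟯) : IsSeparable K a :=
  (IntermediateField.isSeparable_adjoin_simple_iff_isSeparable K E).1 h.separable

theorem IsTame.exists_deg_lt [Normal K E] [IsAlgClosed E]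
    (hw : ∀ (σ : E ≃ₐ[K] E) (x : E), w (σ x) = w x) {a : E} (h : IsTame w K⟮a⟯)
    {τ : E ≃ₐ[K] E} (hτ : τ a ≠ a) :
    ∃ β : E, deg K β < deg K a ∧ w (a - τ a) ≤ w (a - β) := by
  have : FiniteDimensional K K⟮a⟯ :=
    IntermediateField.adjoin.finiteDimensional h.isSeparable.isIntegral
  obtain ⟨c, hc, htr⟩ := h.exists_trace_eq_zero
  exact exists_deg_lt_of_trace hw h.isSeparable hc htr hτ

/-- Krasner's lemma, in terms of degrees. -/
theorem exists_conjugate_ne_of_deg_lt [Normal K E]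
    (hw : ∀ (σ : E ≃ₐ[K] E) (x : E), w (σ x) = w x) {a b : E} (ha : IsSeparable K a)
    (hdeg : deg K b < deg K a) : ∃ σ : E ≃ₐ[K] E, σ a ≠ a ∧ w (a - b) ≤ w (a - σ a) := by
  by_contra! h
  refine absurd (deg_le_of_stabilizer_le ha fun σ hσ => ?_) (not_le.2 hdeg)
  by_contra hne
  refine absurd (h σ hne) (not_lt.2 ?_)
  have h1 : w (σ a - b) = w (a - b) := by
    rw [← hw σ (a - b), map_sub σ, hσ]
  have := w.map_le_sub le_rfl h1.ge
  rwa [sub_sub_sub_cancel_right] at this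

theorem exists_isKrasnerConstant [Normal K E] {a : E} (ha : IsSeparable K a) (hdeg : 1 < deg K a) :
    ∃ d : Γ, IsKrasnerConstant K w a d := by
  have hfin : ((minpoly K a).rootSet E \ {a}).Finite := (Polynomial.rootSet_finite _ _).sdiff
  obtain ⟨b, hb, hba⟩ := Set.exists_ne_of_one_lt_ncard
    ((ncard_rootSet_eq_deg (E := E) ha).symm ▸ hdeg) a
  obtain ⟨m, ⟨hm, hma⟩, hmax⟩ := Set.exists_max_image _ (fun x => w (a - x)) hfin ⟨b, hb, hba⟩
  have htop : w (a - m) ≠ ⊤ := w.ne_top_iff.2 (sub_ne_zero.2 (Ne.symm hma))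
  obtain ⟨d, hd⟩ := WithTop.ne_top_iff_exists.1 htop
  refine ⟨d, ⟨m, hm, hma, hd.symm⟩, ?_⟩
  rintro γ ⟨x, hx, hxa, hγ⟩
  have := hmax x ⟨hx, hxa⟩
  simp only [← hd, hγ] at this
  exact WithTop.coe_le_coe.1 this

theorem IsKrasnerConstant.isMainInvariant [Normal K E] [IsAlgClosed E]
    (hw : ∀ (σ : E ≃ₐ[K] E) (x : E), w (σ x) = w x) {a : E} (h : IsTame w K⟮a⟯) {d : Γ}
    (hd : IsKrasnerConstant K w a d) : IsMainInvariant K w a d := by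
  have hub : ∀ b, deg K b < deg K a → w (a - b) ≤ d := fun b hb => by
    obtain ⟨σ, hσ, hle⟩ := exists_conjugate_ne_of_deg_lt hw h.isSeparable hb
    refine hle.trans ?_
    obtain ⟨γ, hγ⟩ := WithTop.ne_top_iff_exists.1 (w.ne_top_iff.2 (sub_ne_zero.2 hσ.symm))
    rw [← hγ]
    exact WithTop.coe_le_coe.2
      (hd.2 ⟨σ a, mem_rootSet_minpoly_iff.2 ⟨σ, rfl⟩, hσ, hγ.symm⟩)
  obtain ⟨x, hx, hxa, hxd⟩ := hd.1
  obtain ⟨τ, rfl⟩ := mem_rootSet_minpoly_iff.1 hx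
  obtain ⟨β, hβ, hle⟩ := h.exists_deg_lt hw hxa
  refine IsGreatest.isLUB ⟨⟨β, hβ, le_antisymm (hub β hβ) (hxd ▸ hle)⟩, ?_⟩
  rintro γ ⟨b, hb, hγ⟩
  exact WithTop.coe_le_coe.1 (hγ ▸ hub b hb)

theorem algEquiv_eq_self_of_deg_eq_one {a : E} (h : deg K a = 1) (σ : E ≃ₐ[K] E) : σ a = a := by
  obtain ⟨x, rfl⟩ := minpoly.mem_range_of_degree_eq_one K a
    ((Polynomial.degree_eq_iff_natDegree_eq_of_pos one_pos).2 h)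
  exact σ.commutes x

namespace IsOkutsuSequence

variable {θ : E} {r : ℕ} {α : Fin (r + 1) → E}

theorem lt_of_add_one_eq (hα : IsOkutsuSequence K w θ α) {i j : Fin (r + 1)}
    (hij : (j : ℕ) + 1 = i) : w (θ - α j) < w (θ - α i) := by
  have hdeg : deg K (α j) < deg K (α i) := hα.deg_strictMono (Fin.lt_def.2 (by omega))
  induction i using Fin.lastCases with
  | last =>
    rw [hα.last_eq] at hdeg ⊢
    rw [sub_self, w.map_zero, lt_top_iff_ne_top, w.ne_top_iff, sub_ne_zero]
    rintro h
    rw [← h] at hdeg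
    exact lt_irrefl _ hdeg
  | cast i => exact hα.lt_of_deg_lt i _ hdeg

/-- Otherwise `σ` moves `α i` by exactly `w (θ - σ θ)`, and the approximation of `α i` of smaller
degree is closer to `θ` than `α_{i-1}`. For `i = 0` there is no predecessor, but `α 0` lies in `K`
and cannot move. -/
theorem le_of_lt_of_isTame [Normal K E] [IsAlgClosed E] (hα : IsOkutsuSequence K w θ α)
    (hw : ∀ (σ : E ≃ₐ[K] E) (x : E), w (σ x) = w x) {i : Fin (r + 1)} (hi : IsTame w K⟮α i⟯)
    {σ : E ≃ₐ[K] E}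
    (hσ : ∀ j : Fin (r + 1), (j : ℕ) + 1 = i → w (θ - α j) < w (θ - σ θ)) :
    w (θ - α i) ≤ w (θ - σ θ) := by
  by_contra! h
  have hσα : w (σ θ - σ (α i)) = w (θ - α i) := by rw [← map_sub, hw]
  have h1 : w (α i - σ (α i)) = w (θ - σ θ) := by
    -- The second summand has value at least `w (θ - α i)`, so the first dominates.
    have h2 : α i - σ (α i) = (θ - σ θ) + ((σ θ - σ (α i)) - (θ - α i)) := by ring
    rw [h2]
    exact w.map_add_eq_of_lt_left (h.trans_le (w.map_le_sub hσα.ge le_rfl))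
  have hne : σ (α i) ≠ α i := fun he => by
    rw [he, sub_self, w.map_zero] at h1
    exact not_top_lt (h1 ▸ h)
  induction i using Fin.cases with
  | zero => exact hne (algEquiv_eq_self_of_deg_eq_one hα.deg_zero σ)
  | succ i =>
    obtain ⟨β, hβ, hle⟩ := hi.exists_deg_lt hw hne
    have h3 := w.map_le_add (h.le) (h1 ▸ hle)
    rw [sub_add_sub_cancel] at h3
    have h4 := hσ i.castSucc (by simp)
    exact absurd (h4.trans_le h3) (not_lt.2 (hα.le_of_deg_lt_succ i β hβ))

theorem H_eq_HBar [Normal K E] [IsAlgClosed E] (hα : IsOkutsuSequence K w θ α)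
    (hw : ∀ (σ : E ≃ₐ[K] E) (x : E), w (σ x) = w x) {i : Fin (r + 1)} (hi : IsTame w K⟮α i⟯)
    {M : IntermediateField K E} (hθ : θ ∈ M) :
    H w (⟨θ, hθ⟩ : M) α i = HBar w (⟨θ, hθ⟩ : M) α i := by
  ext σ
  have hσ : σ.liftNormal E θ = (σ ⟨θ, hθ⟩ : M) := σ.liftNormal_commutes E ⟨θ, hθ⟩
  simp only [H, HBar, Set.mem_ofPred_eq, ← hσ]
  exact ⟨fun h => hα.le_of_lt_of_isTame hw hi h,
    fun h j hj => (hα.lt_of_add_one_eq hj).trans_le h⟩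

end IsOkutsuSequence

end MainInvariant

end TameOkutsu

theorem corollary4p2
    {Γ : Type*} [AddCommGroup Γ] [LinearOrder Γ] [IsOrderedAddMonoid Γ]
    {K Kbar : Type*} [Field K] [Field Kbar] [Algebra K Kbar] [IsAlgClosure K Kbar]
    (v : AddValuation K (WithTop Γ)) (hv : TameOkutsu.IsHenselian Kbar v)
    (vbar : AddValuation Kbar (WithTop Γ)) (hvbar : ∀ x : K, vbar (algebraMap K Kbar x) = v x)
    (θ : Kbar) (hsep : IsSeparable K θ) (hdef : TameOkutsu.IsDefectless vbar K⟮θ⟯) :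
    (∀ (r : ℕ) (α : Fin (r + 1) → Kbar), TameOkutsu.IsOkutsuSequence K vbar θ α →
      ∀ i : Fin (r + 1), TameOkutsu.IsTame vbar K⟮α i⟯ →
      ∀ (M : IntermediateField K Kbar) [FiniteDimensional K M] [IsGalois K M]
        (hθ : θ ∈ M), α i ∈ M →
        TameOkutsu.H vbar (⟨θ, hθ⟩ : M) α i = TameOkutsu.HBar vbar (⟨θ, hθ⟩ : M) α i) ∧
    (1 < TameOkutsu.deg K θ → TameOkutsu.IsTame vbar K⟮θ⟯ →
      ∃ d : Γ, TameOkutsu.IsMainInvariant K vbar θ d ∧ TameOkutsu.IsKrasnerConstant K vbar θ d) := by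
  have : IsAlgClosed Kbar := IsAlgClosure.isAlgClosed K
  have : Normal K Kbar := IsAlgClosure.normal K Kbar
  have hw := hv.map_algEquiv hvbar
  refine ⟨fun r α hα i hi M _ _ hθ _ => hα.H_eq_HBar hw hi hθ, fun hdeg htame => ?_⟩
  obtain ⟨d, hd⟩ := TameOkutsu.exists_isKrasnerConstant (w := vbar) hsep hdeg
  exact ⟨d, hd.isMainInvariant hw htame, hd⟩
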